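/- Conventions. A set of reals means an infinite zero-dimensional subspace $X\subseteq\mathbb{R}$ (zero-dimensional: the relatively clopen sets form a base). A cover of $X$ is a family $\mathcal{U}$ of subsets of $X$ with $\bigcup\mathcal{U}=X$ and $X\notin\mathcal{U}$. It is - an $\omega$-cover if every finite subset of $X$ is contained in some member of $\mathcal{U}$; - a $\gamma$-cover if $\mathcal{U}$ is infinite and every $x\in X$ belongs to all but finitely many members of $\mathcal{U}$; - a $\tau$-cover if every $x\in X$ belongs to infinitely many members of $\mathcal{U}$, and for all $x,y\in X$, either ($x\in U$ implies $y\in U$) for all but finitely many $U\in\mathcal{U}$, or ($y\in U$ implies $x\in U$) for all but finitely many $U\in\mathcal{U}$. Let $\Omega,\mathrm{T},\Gamma$ (respectively $\mathcal{B}_\Omega,\mathcal{B}_{\mathrm{T}},\mathcal{B}_\Gamma$) denote the collections of countable open (respectively countable Borel) $\omega$-, $\tau$- and $\gamma$-covers of $X$, where open and Borel refer to the subspace topology. For collections $\mathfrak{U},\mathfrak{V}$ of covers of $X$: - $X$ satisfies $\mathsf{S}_1(\mathfrak{U},\mathfrak{V})$ if for each sequence $(\mathcal{U}_n)_{n\in\mathbb{N}}$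 of members of $\mathfrak{U}$ there are $V_n\in\mathcal{U}_n$ ($n\in\mathbb{N}$) such that $\{V_n:n\in\mathbb{N}\}\in\mathfrak{V}$; - $X$ satisfies $\binom{\mathfrak{U}}{\mathfrak{V}}$ if each $\mathcal{U}\in\mathfrak{U}$ contains a subfamily $\mathcal{V}\subseteq\mathcal{U}$ with $\mathcal{V}\in\mathfrak{V}$. Each property is identified with the class of all sets of reals satisfying it. Theorem. Assume the Continuum Hypothesis, $2^{\aleph_0}=\aleph_1$. Then there exist sets of reals $A$ and $B$, each satisfying $\mathsf{S}_1(\mathcal{B}_\Omega,\mathcal{B}_\Gamma)$, such that $A\cup B$ is again a set of reals in the above sense and does not satisfy $\binom{\Omega}{\mathrm{T}}$. Moreover, $\mathsf{S}_1(\mathrm{T},\Gamma)\neq\mathsf{S}_1(\Omega,\Gamma)$ and $\mathsf{S}_1(\mathcal{B}_{\mathrm{T}},\mathcal{B}_\Gamma)\neq\mathsf{S}_1(\mathcal{B}_\Omega,\mathcal{B}_\Gamma)$. -/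

import Mathlib

namespace TauCovers

/-- A cover of the space `X`; the whole space is never an element of a cover. -/
def IsCover {X : Type*} (𝒰 : Set (Set X)) : Prop :=
  ⋃₀ 𝒰 = Set.univ ∧ Set.univ ∉ 𝒰

/-- An `ω`-cover: each finite subset of `X` is contained in some member of the cover. -/
def IsOmegaCover {X : Type*} (𝒰 : Set (Set X)) : Prop :=
  IsCover 𝒰 ∧ ∀ F : Set X, F.Finite → ∃ U ∈ 𝒰, F ⊆ U

/-- A `γ`-cover: an infinite cover such that each point belongs to all but finitely many
members of the cover. -/
def IsGammaCover {X : Type*} (𝒰 : Set (Set X)) : Prop :=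
  IsCover 𝒰 ∧ 𝒰.Infinite ∧ ∀ x : X, {U ∈ 𝒰 | x ∉ U}.Finite

/-- A large cover: each point belongs to infinitely many members of the cover. -/
def IsLargeCover {X : Type*} (𝒰 : Set (Set X)) : Prop :=
  IsCover 𝒰 ∧ ∀ x : X, {U ∈ 𝒰 | x ∈ U}.Infinite

/-- The relation `x ≼ y` induced by `𝒰`: `x ∈ U` implies `y ∈ U` for all but finitely many
`U ∈ 𝒰`. -/
def CoverLE {X : Type*} (𝒰 : Set (Set X)) (x y : X) : Prop :=
  {U ∈ 𝒰 | ¬ (x ∈ U → y ∈ U)}.Finite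

/-- A `τ`-cover: a large cover whose induced relation is total. -/
def IsTauCover {X : Type*} (𝒰 : Set (Set X)) : Prop :=
  IsLargeCover 𝒰 ∧ ∀ x y : X, CoverLE 𝒰 x y ∨ CoverLE 𝒰 y x

/-- A countable family of open sets. -/
def IsCountableOpen {X : Type*} [TopologicalSpace X] (𝒰 : Set (Set X)) : Prop :=
  𝒰.Countable ∧ ∀ U ∈ 𝒰, IsOpen U

/-- A countable family of Borel sets. -/
def IsCountableBorel {X : Type*} [TopologicalSpace X] (𝒰 : Set (Set X)) : Prop :=
  𝒰.Countable ∧ ∀ U ∈ 𝒰, @MeasurableSet X (borel X) U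

section Collections

variable (X : Type*) [TopologicalSpace X]

/-- `Ω`: the countable open `ω`-covers of `X`. -/
def openOmega : Set (Set (Set X)) := {𝒰 | IsCountableOpen 𝒰 ∧ IsOmegaCover 𝒰}

/-- `T`: the countable open `τ`-covers of `X`. -/
def openTau : Set (Set (Set X)) := {𝒰 | IsCountableOpen 𝒰 ∧ IsTauCover 𝒰}

/-- `Γ`: the countable open `γ`-covers of `X`. -/
def openGamma : Set (Set (Set X)) := {𝒰 | IsCountableOpen 𝒰 ∧ IsGammaCover 𝒰}

/-- `B_Ω`: the countable Borel `ω`-covers of `X`. -/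
def borelOmega : Set (Set (Set X)) := {𝒰 | IsCountableBorel 𝒰 ∧ IsOmegaCover 𝒰}

/-- `B_T`: the countable Borel `τ`-covers of `X`. -/
def borelTau : Set (Set (Set X)) := {𝒰 | IsCountableBorel 𝒰 ∧ IsTauCover 𝒰}

/-- `B_Γ`: the countable Borel `γ`-covers of `X`. -/
def borelGamma : Set (Set (Set X)) := {𝒰 | IsCountableBorel 𝒰 ∧ IsGammaCover 𝒰}

end Collections

/-- The selection principle `S₁(𝔘, 𝔙)`. -/
def S1 {X : Type*} (𝔘 𝔙 : Set (Set (Set X))) : Prop :=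
  ∀ 𝒰 : ℕ → Set (Set X), (∀ n, 𝒰 n ∈ 𝔘) →
    ∃ V : ℕ → Set X, (∀ n, V n ∈ 𝒰 n) ∧ Set.range V ∈ 𝔙

/-- The property `𝔘` choose `𝔙`: each cover in `𝔘` contains a subcover in `𝔙`. -/
def Choose {X : Type*} (𝔘 𝔙 : Set (Set (Set X))) : Prop :=
  ∀ 𝒰 ∈ 𝔘, ∃ 𝒱, 𝒱 ⊆ 𝒰 ∧ 𝒱 ∈ 𝔙

/-- The sets of reals under consideration: infinite, and zero-dimensional as subspaces of `ℝ`,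
that is, with a base of (relatively) clopen sets. -/
def IsAdmissible (A : Set ℝ) : Prop :=
  A.Infinite ∧ TopologicalSpace.IsTopologicalBasis {s : Set A | IsClopen s}

end TauCovers

open Filter Set

namespace TauCovers

/-- For every sequence of Borel families each of which catches all finite subsets of `S` in single
members, one can select a member of each family so that every point of `S` is in all but finitely
many of the selected sets. -/
def IsBorelSelective {X : Type*} [MeasurableSpace X] (S : Set X) : Prop :=
  ∀ W : ℕ → ℕ → Set X, (∀ n k, MeasurableSet (W n k)) →
    (∀ n, ∀ F ⊆ S, F.Finite → ∃ k, F ⊆ W n k) →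
    ∃ g : ℕ → ℕ, ∀ x ∈ S, ∀ᶠ n in atTop, x ∈ W n (g n)

theorem IsBorelSelective.image {X Y : Type*} [MeasurableSpace X] [MeasurableSpace Y] {S : Set X}
    (hS : IsBorelSelective S) {φ : X → Y} (hφ : Measurable φ) : IsBorelSelective (φ '' S) := by
  intro W hW h
  obtain ⟨g, hg⟩ := hS (fun n k => φ ⁻¹' W n k) (fun n k => hφ (hW n k)) (by
    intro n F hF hfin
    obtain ⟨k, hk⟩ := h n (φ '' F) (image_mono hF) (hfin.image φ)
    exact ⟨k, image_subset_iff.1 hk⟩)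
  refine ⟨g, ?_⟩
  rintro _ ⟨x, hx, rfl⟩
  exact hg x hx

theorem IsBorelSelective.preimage_val {X : Type*} [MeasurableSpace X] {S Z : Set X}
    (hS : IsBorelSelective S) (hSZ : S ⊆ Z) : IsBorelSelective ((↑) ⁻¹' S : Set Z) := by
  intro W hW h
  have hW₀ : ∀ n k, ∃ s : Set X, MeasurableSet s ∧ ((↑) ⁻¹' s : Set Z) = W n k := hW
  choose W' hW' hWW' using hW₀
  obtain ⟨g, hg⟩ := hS W' hW' (by
    intro n F hF hfin
    obtain ⟨k, hk⟩ := h n ((↑) ⁻¹' F) (preimage_mono hF)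
      (hfin.preimage Subtype.val_injective.injOn)
    refine ⟨k, fun x hx => ?_⟩
    have : (⟨x, hSZ (hF hx)⟩ : Z) ∈ W n k := hk hx
    rwa [← hWW'] at this)
  refine ⟨g, fun x hx => (hg x hx).mono fun n hn => ?_⟩
  rw [← hWW']
  exact hn

theorem isGammaCover_range {X : Type*} [Nonempty X] {V : ℕ → Set X} (hV : ∀ n, V n ≠ univ)
    (h : ∀ x, ∀ᶠ n in atTop, x ∈ V n) : IsGammaCover (range V) := by
  refine ⟨⟨?_, ?_⟩, ?_, ?_⟩
  · refine eq_univ_of_forall fun x => ?_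
    obtain ⟨n, hn⟩ := (h x).exists
    exact ⟨V n, mem_range_self n, hn⟩
  · rintro ⟨n, hn⟩
    exact hV n hn
  · intro hfin
    have hall : ∀ᶠ n in atTop, ∀ U ∈ range V, n ∈ {n | V n = U} → U = univ := by
      rw [eventually_all_finite hfin]
      intro U _
      by_cases hU : U = univ
      · simp [hU]
      · obtain ⟨x, hx⟩ := (ne_univ_iff_exists_notMem U).1 hU
        filter_upwards [h x] with n hn hnU
        have : V n = U := hnU
        exact absurd (this ▸ hn) hx
    obtain ⟨n, hn⟩ := hall.exists
    exact hV n (hn (V n) (mem_range_self n) rfl)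
  · intro x
    have hx := h x
    rw [← Nat.cofinite_eq_atTop] at hx
    refine (Set.Finite.image V (eventually_cofinite.1 hx)).subset ?_
    rintro _ ⟨⟨n, rfl⟩, hn⟩
    exact ⟨n, hn, rfl⟩

theorem IsGammaCover.isTauCover {X : Type*} {𝒰 : Set (Set X)} (h : IsGammaCover 𝒰) :
    IsTauCover 𝒰 := by
  obtain ⟨h1, h2, h3⟩ := h
  refine ⟨⟨h1, fun x => ?_⟩, fun x y => Or.inl ((h3 y).subset ?_)⟩
  · refine ((h2.sdiff (h3 x))).mono ?_
    rintro U ⟨hU, hxU⟩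
    exact ⟨hU, by_contra fun h => hxU ⟨hU, h⟩⟩
  · rintro U ⟨hU, hxy⟩
    exact ⟨hU, fun h => hxy fun _ => h⟩

theorem IsBorelSelective.s1 {X : Type*} [Nonempty X] [TopologicalSpace X] [MeasurableSpace X]
    [BorelSpace X] (h : IsBorelSelective (univ : Set X)) : S1 (borelOmega X) (borelGamma X) := by
  intro 𝒰 h𝒰
  have hne : ∀ n, (𝒰 n).Nonempty := fun n => by
    obtain ⟨U, hU, -⟩ := (h𝒰 n).2.2 ∅ finite_empty
    exact ⟨U, hU⟩
  choose u hu using fun n => (h𝒰 n).1.1.exists_eq_range (hne n)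
  have hmem : ∀ n k, u n k ∈ 𝒰 n := fun n k => by rw [hu n]; exact mem_range_self k
  have hmeas : ∀ n k, MeasurableSet (u n k) := fun n k => by
    rw [BorelSpace.measurable_eq (α := X)]
    exact (h𝒰 n).1.2 _ (hmem n k)
  obtain ⟨g, hg⟩ := h u hmeas (by
    intro n F _ hF
    obtain ⟨U, hU, hFU⟩ := (h𝒰 n).2.2 F hF
    rw [hu n] at hU
    obtain ⟨k, rfl⟩ := hU
    exact ⟨k, hFU⟩)
  refine ⟨fun n => u n (g n), fun n => hmem n _, ⟨countable_range _, ?_⟩,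
    isGammaCover_range (fun n hn => (h𝒰 n).2.1.2 (hn ▸ hmem n (g n))) fun x => hg x (mem_univ x)⟩
  rintro _ ⟨n, rfl⟩
  exact (h𝒰 n).1.2 _ (hmem n _)

/-- In a family of subsets of `ℕ` that is linear modulo finite sets, finitely many members that
meet `N` in an infinite set have an infinite intersection with `N`. -/
theorem infinite_inter_of_linear {X : Type*} {K : X → Set ℕ} {N : Set ℕ} (hN : N.Infinite)
    (htot : ∀ x y, (K x \ K y).Finite ∨ (K y \ K x).Finite) {F : Set X} (hF : F.Finite)
    (hK : ∀ x ∈ F, (N ∩ K x).Infinite) : {k ∈ N | ∀ x ∈ F, k ∈ K x}.Infinite := by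
  rcases F.eq_empty_or_nonempty with rfl | hne
  · simpa using hN
  have hmin : ∃ x ∈ F, ∀ y ∈ F, (K x \ K y).Finite := by
    clear hK
    induction F, hF using Set.Finite.induction_on with
    | empty => exact absurd hne (by simp)
    | @insert a F ha hF ih =>
      rcases F.eq_empty_or_nonempty with rfl | hne'
      · exact ⟨a, by simp, by simp⟩
      obtain ⟨x, hx, hxF⟩ := ih hne'
      rcases htot x a with h | h
      · refine ⟨x, Or.inr hx, ?_⟩
        rintro y (rfl | hy)
        exacts [h, hxF y hy]
      · refine ⟨a, Or.inl rfl, ?_⟩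
        rintro y (rfl | hy)
        · simp
        · refine (h.union (hxF y hy)).subset ?_
          rintro k ⟨hk, hk'⟩
          by_cases hkx : k ∈ K x
          exacts [Or.inr ⟨hkx, hk'⟩, Or.inl ⟨hk, hkx⟩]
  obtain ⟨x, hx, hxF⟩ := hmin
  have hfin : (⋃ y ∈ F, K x \ K y).Finite := hF.biUnion hxF
  refine ((hK x hx).sdiff hfin).mono ?_
  rintro k ⟨⟨hkN, hkx⟩, hk⟩
  refine ⟨hkN, fun y hy => by_contra fun hky => hk ?_⟩
  exact mem_biUnion hy ⟨hkx, hky⟩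

theorem IsBorelSelective.exists_subsequence {X : Type*} [MeasurableSpace X] {S : Set X}
    (hS : IsBorelSelective S) {u : ℕ → Set X} (hu : ∀ k, MeasurableSet (u k)) {N : Set ℕ}
    (hN : N.Infinite) (htot : ∀ x y, ({k | x ∈ u k} \ {k | y ∈ u k}).Finite ∨
      ({k | y ∈ u k} \ {k | x ∈ u k}).Finite)
    (hK : ∀ x ∈ S, (N ∩ {k | x ∈ u k}).Infinite) :
    ∃ φ : ℕ → ℕ, Tendsto φ atTop atTop ∧ (∀ n, φ n ∈ N) ∧
      ∀ x ∈ S, ∀ᶠ n in atTop, x ∈ u (φ n) := by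
  obtain ⟨ν, hν, hνN⟩ : ∃ ν : ℕ → ℕ, StrictMono ν ∧ range ν = N :=
    ⟨Nat.nth (· ∈ N), Nat.nth_strictMono hN, Nat.range_nth_of_infinite hN⟩
  obtain ⟨g, hg⟩ := hS (fun n k => u (ν (n + k))) (fun n k => hu _) (by
    intro n F hFS hF
    obtain ⟨k, ⟨hkN, hk⟩, hle⟩ :=
      Set.Infinite.exists_gt
        (infinite_inter_of_linear hN htot hF fun x hx => hK x (hFS hx)) (ν n)
    rw [← hνN] at hkN
    obtain ⟨j, rfl⟩ := hkN
    obtain ⟨i, rfl⟩ := Nat.exists_eq_add_of_le (hν.le_iff_le.1 hle.le)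
    exact ⟨i, fun x hx => hk x hx⟩)
  refine ⟨fun n => ν (n + g n), ?_, fun n => hνN ▸ mem_range_self _, hg⟩
  refine hν.tendsto_atTop.comp (tendsto_atTop_mono (fun n => Nat.le_add_right n (g n)) tendsto_id)

theorem exists_gamma_subsequence {X : Type*} [MeasurableSpace X] {S T : Set X}
    (hS : IsBorelSelective S) (hT : IsBorelSelective T) (hST : S ∪ T = univ)
    {u : ℕ → Set X} (hu : ∀ k, MeasurableSet (u k))
    (hinf : ∀ x, {k | x ∈ u k}.Infinite)
    (htot : ∀ x y, ({k | x ∈ u k} \ {k | y ∈ u k}).Finite ∨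
      ({k | y ∈ u k} \ {k | x ∈ u k}).Finite) :
    ∃ φ : ℕ → ℕ, ∀ x, ∀ᶠ n in atTop, x ∈ u (φ n) := by
  have key : ∀ {φ : ℕ → ℕ} {x y : X}, Tendsto φ atTop atTop →
      ({k | x ∈ u k} \ {k | y ∈ u k}).Finite → (∀ᶠ n in atTop, x ∈ u (φ n)) →
      ∀ᶠ n in atTop, y ∈ u (φ n) := by
    intro φ x y hφ hfin hx
    have h1 : ∀ᶠ k in atTop, k ∉ {k | x ∈ u k} \ {k | y ∈ u k} := by
      rw [← Nat.cofinite_eq_atTop]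
      exact hfin.eventually_cofinite_notMem
    filter_upwards [hx, hφ.eventually h1] with n h2 h3
    by_contra h4
    exact h3 ⟨h2, h4⟩
  by_cases hcase : ∃ b ∈ T, ∀ a ∈ S, ({k | b ∈ u k} \ {k | a ∈ u k}).Finite
  · obtain ⟨b, hb, hbS⟩ := hcase
    obtain ⟨φ, hφ, hφN, hφT⟩ := hT.exists_subsequence hu (hinf b) htot (by
      intro x _
      rcases htot b x with h | h
      · refine ((hinf b).sdiff h).mono fun k hk => ⟨hk.1, by_contra fun h' => hk.2 ⟨hk.1, h'⟩⟩
      · refine ((hinf x).sdiff h).mono fun k hk => ⟨by_contra fun h' => hk.2 ⟨hk.1, h'⟩, hk.1⟩)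
    refine ⟨φ, fun x => ?_⟩
    rcases (hST.symm ▸ mem_univ x : x ∈ S ∪ T) with hx | hx
    · exact key hφ (hbS x hx) (Eventually.of_forall hφN)
    · exact hφT x hx
  · push Not at hcase
    obtain ⟨φ, hφ, -, hφS⟩ := hS.exists_subsequence hu infinite_univ htot
      (by simpa using fun x _ => hinf x)
    refine ⟨φ, fun x => ?_⟩
    rcases (hST.symm ▸ mem_univ x : x ∈ S ∪ T) with hx | hx
    · exact hφS x hx
    · obtain ⟨a, ha, hna⟩ := hcase x hx
      exact key hφ ((htot a x).resolve_right hna) (hφS a ha)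

theorem exists_selection_of_gamma {X : Type*} [MeasurableSpace X] {S T : Set X}
    (hS : IsBorelSelective S) (hT : IsBorelSelective T) (hST : S ∪ T = univ)
    {w : ℕ → ℕ → Set X} (hw : ∀ n k, MeasurableSet (w n k))
    (hg : ∀ n x, ∀ᶠ k in atTop, x ∈ w n k) :
    ∃ g : ℕ → ℕ, ∀ x, ∀ᶠ n in atTop, x ∈ w n (g n) := by
  have hm : ∀ n m, MeasurableSet (⋂ j ∈ {j | m ≤ j}, w n j) := fun n m =>
    MeasurableSet.biInter (to_countable _) fun j _ => hw n j
  have hω : ∀ R : Set X, ∀ n, ∀ F ⊆ R, F.Finite → ∃ m, F ⊆ ⋂ j ∈ {j | m ≤ j}, w n j := by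
    intro R n F _ hF
    have : ∀ᶠ k in atTop, ∀ x ∈ F, x ∈ w n k := (eventually_all_finite hF).2 fun x _ => hg n x
    obtain ⟨m, hm⟩ := eventually_atTop.1 this
    exact ⟨m, fun x hx => mem_iInter₂.2 fun j hj => hm j hj x hx⟩
  obtain ⟨g₁, h₁⟩ := hS _ hm (hω S)
  obtain ⟨g₂, h₂⟩ := hT _ hm (hω T)
  refine ⟨fun n => max (g₁ n) (g₂ n), fun x => ?_⟩
  rcases (hST.symm ▸ mem_univ x : x ∈ S ∪ T) with hx | hx
  · exact (h₁ x hx).mono fun n hn => mem_iInter₂.1 hn _ (le_max_left (g₁ n) (g₂ n))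
  · exact (h₂ x hx).mono fun n hn => mem_iInter₂.1 hn _ (le_max_right (g₁ n) (g₂ n))

theorem exists_selection_of_tau {X : Type*} [Nonempty X] [MeasurableSpace X] {S T : Set X}
    (hS : IsBorelSelective S) (hT : IsBorelSelective T) (hST : S ∪ T = univ)
    {𝒰 : ℕ → Set (Set X)} (hc : ∀ n, (𝒰 n).Countable)
    (hm : ∀ n, ∀ U ∈ 𝒰 n, MeasurableSet U) (hτ : ∀ n, IsTauCover (𝒰 n)) :
    ∃ V : ℕ → Set X, (∀ n, V n ∈ 𝒰 n) ∧ ∀ x, ∀ᶠ n in atTop, x ∈ V n := by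
  have henum : ∀ n, ∃ u : ℕ → Set X, Function.Injective u ∧ range u = 𝒰 n := by
    intro n
    have hinf : (𝒰 n).Infinite :=
      ((hτ n).1.2 (Classical.arbitrary X)).mono fun U hU => hU.1
    have := hinf.to_subtype
    have := (hc n).to_subtype
    obtain ⟨e⟩ := nonempty_equiv_of_countable (α := ℕ) (β := 𝒰 n)
    exact ⟨fun k => e k, Subtype.val_injective.comp e.injective, by
      rw [range_comp' Subtype.val e, e.range_eq_univ, image_univ, Subtype.range_val]⟩
  choose u hinj hu using henum
  have hmem : ∀ n k, u n k ∈ 𝒰 n := fun n k => hu n ▸ mem_range_self k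
  have hum : ∀ n k, MeasurableSet (u n k) := fun n k => hm n _ (hmem n k)
  have hle : ∀ n x y, CoverLE (𝒰 n) x y → ({k | x ∈ u n k} \ {k | y ∈ u n k}).Finite := by
    intro n x y h
    refine (Set.Finite.preimage (hinj n).injOn h).subset ?_
    rintro k ⟨hk, hk'⟩
    exact ⟨hmem n k, fun h => hk' (h hk)⟩
  have hsub : ∀ n, ∃ φ : ℕ → ℕ, ∀ x, ∀ᶠ k in atTop, x ∈ u n (φ k) := fun n =>
    exists_gamma_subsequence hS hT hST (hum n) (by
      intro x hfin
      refine (hτ n).1.2 x ((hfin.image (u n)).subset ?_)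
      rintro U ⟨hU, hxU⟩
      rw [← hu n] at hU
      obtain ⟨k, rfl⟩ := hU
      exact ⟨k, hxU, rfl⟩)
      fun x y => ((hτ n).2 x y).imp (hle n x y) (hle n y x)
  choose φ hφ using hsub
  obtain ⟨g, hg⟩ := exists_selection_of_gamma hS hT hST (w := fun n k => u n (φ n k))
    (fun n k => hum n _) hφ
  exact ⟨fun n => u n (φ n (g n)), fun n => hmem n _, hg⟩

/-- The points of the Cantor space that agree with `x` at all places outside `D` from `m` on. -/
def cyl (m : ℕ) (D : Set ℕ) (x : ℕ → Bool) : Set (ℕ → Bool) :=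
  {y | ∀ j, m ≤ j → j ∉ D → y j = x j}

/-- The points of the Cantor space that agree with `x` at all but finitely many places
outside `D`. -/
def hull (D : Set ℕ) (x : ℕ → Bool) : Set (ℕ → Bool) :=
  {y | {j | j ∉ D ∧ y j ≠ x j}.Finite}

theorem cyl_subset_hull (m : ℕ) (D : Set ℕ) (x : ℕ → Bool) : cyl m D x ⊆ hull D x := by
  intro y hy
  refine (finite_Iio m).subset ?_
  rintro j ⟨hj, hne⟩
  exact not_le.1 fun h => hne (hy j h hj)

theorem exists_mem_cyl_of_mem_hull {D : Set ℕ} {x y : ℕ → Bool} (hy : y ∈ hull D x) :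
    ∃ N, ∀ m ≥ N, y ∈ cyl m D x := by
  obtain ⟨N, hN⟩ := (show {j | j ∉ D ∧ y j ≠ x j}.Finite from hy).bddAbove
  refine ⟨N + 1, fun m hm j hj hjD => by_contra fun hne => ?_⟩
  have := hN ⟨hjD, hne⟩
  lia

theorem mem_hull_of_eq {D : Set ℕ} {x y : ℕ → Bool} (h : ∀ j, j ∉ D → y j = x j) :
    y ∈ hull D x :=
  cyl_subset_hull 0 D x fun j _ hj => h j hj

theorem hull_subset_hull {D D' : Set ℕ} {x x' : ℕ → Bool} (hD : (D' \ D).Finite)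
    (hx : x' ∈ hull D x) : hull D' x' ⊆ hull D x := by
  intro y hy
  refine ((hD.union hx).union hy).subset ?_
  rintro j ⟨hj, hne⟩
  by_cases hjD : j ∈ D'
  · exact Or.inl (Or.inl ⟨hjD, hj⟩)
  by_cases hjx : x' j = x j
  · exact Or.inr ⟨hjD, fun h => hne (h.trans hjx)⟩
  · exact Or.inl (Or.inr ⟨hj, hjx⟩)

/-- Fusion: conditions that can be refined step by step, keeping longer and longer initial
segments, have a common refinement. -/
theorem exists_fusion {C : Set ℕ → (ℕ → Bool) → Prop}
    (hC : ∀ D x, C D x → D.Infinite)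
    {𝒮 : ℕ → Set (Set (ℕ → Bool))} (hmono : ∀ n T T', T' ⊆ T → T ∈ 𝒮 n → T' ∈ 𝒮 n)
    (hstep : ∀ n m D (x : ℕ → Bool), C D x → ∃ (D' : Set ℕ) (x' : ℕ → Bool), C D' x' ∧ D' ⊆ D ∧ (∀ j ∈ D, j < m → j ∈ D') ∧
      (∀ j, j ∉ D → x' j = x j) ∧ cyl m D' x' ∈ 𝒮 n)
    {D : Set ℕ} {x : ℕ → Bool} (hD : C D x) :
    ∃ D' x', D'.Infinite ∧ D' ⊆ D ∧ (∀ j, j ∉ D → x' j = x j) ∧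
      ∃ μ : ℕ → ℕ, (∀ n, n ≤ μ n) ∧ ∀ n, cyl (μ n) D' x' ∈ 𝒮 n := by
  have hnext : ∀ (n : ℕ) (p : {p : Set ℕ × (ℕ → Bool) × ℕ // C p.1 p.2.1}),
      ∃ q : {p : Set ℕ × (ℕ → Bool) × ℕ // C p.1 p.2.1}, q.1.1 ⊆ p.1.1 ∧
        (∀ j ∈ p.1.1, j < p.1.2.2 → j ∈ q.1.1) ∧ (∀ j, j ∉ p.1.1 → q.1.2.1 j = p.1.2.1 j) ∧
        cyl p.1.2.2 q.1.1 q.1.2.1 ∈ 𝒮 n ∧ ∃ c ∈ q.1.1, p.1.2.2 ≤ c ∧ c < q.1.2.2 := by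
    rintro n ⟨⟨D, x, m⟩, hD⟩
    obtain ⟨D', x', hD', h1, h2, h3, h4⟩ := hstep n m D x hD
    obtain ⟨c, hc, hmc⟩ := (hC D' x' hD').exists_gt m
    exact ⟨⟨⟨D', x', c + 1⟩, hD'⟩, h1, h2, h3, h4, c, hc, hmc.le, Nat.lt_succ_self c⟩
  choose next hsub hkeep hagree hmem hnew using hnext
  let σ : ℕ → {p : Set ℕ × (ℕ → Bool) × ℕ // C p.1 p.2.1} :=
    fun n => Nat.rec ⟨⟨D, x, 0⟩, hD⟩ (fun n p => next n p) n
  let Δ : ℕ → Set ℕ := fun n => (σ n).1.1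
  let ξ : ℕ → ℕ → Bool := fun n => (σ n).1.2.1
  let μ : ℕ → ℕ := fun n => (σ n).1.2.2
  have hΔ : Antitone Δ := antitone_nat_of_succ_le fun n => hsub n (σ n)
  have hμ : StrictMono μ := strictMono_nat_of_lt_succ fun n => by
    obtain ⟨c, -, h1, h2⟩ := hnew n (σ n)
    exact h1.trans_lt h2
  have hξ : ∀ n l, n ≤ l → ∀ j, j ∉ Δ n → ξ l j = ξ n j := by
    intro n l hnl j hj
    induction l, hnl using Nat.le_induction with
    | base => rfl
    | succ l hl ih =>
      exact (hagree l (σ l) j fun h => hj (hΔ hl h)).trans ih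
  have hK : ∀ n l, n ≤ l → ∀ j ∈ Δ n, j < μ n → j ∈ Δ l := by
    intro n l hnl j hj hjn
    induction l, hnl using Nat.le_induction with
    | base => exact hj
    | succ l hl ih => exact hkeep l (σ l) j ih (hjn.trans_le (hμ.monotone hl))
  classical
  let y : ℕ → Bool := fun j => if h : ∃ n, j ∉ Δ n then ξ (Nat.find h) j else x j
  have hy : ∀ n j, j ∉ Δ n → y j = ξ n j := by
    intro n j hj
    have h : ∃ n, j ∉ Δ n := ⟨n, hj⟩
    simp only [y, dif_pos h]
    exact (hξ _ _ (Nat.find_min' h hj) j (Nat.find_spec h)).symm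
  refine ⟨⋂ n, Δ n, y, ?_, iInter_subset Δ 0, fun j hj => hy 0 j hj, μ, fun n => hμ.le_apply, fun n => ?_⟩
  · rw [Set.infinite_iff_exists_gt]
    intro n
    obtain ⟨c, hc, h1, h2⟩ := hnew (n + 1) (σ (n + 1))
    refine ⟨c, mem_iInter.2 fun l => ?_, ?_⟩
    · rcases le_total (n + 2) l with h | h
      · exact hK (n + 2) l h c hc h2
      · exact hΔ h hc
    · have := hμ.le_apply (x := n + 1)
      exact lt_of_lt_of_le (Nat.lt_succ_self n) (this.trans h1)
  · refine hmono n _ _ ?_ (hmem n (σ n))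
    intro z hz j hj hjD
    have hjD' : j ∉ Δ (n + 1) := hjD
    exact (hz j hj fun h => hjD' (mem_iInter.1 h (n + 1))).trans (hy (n + 1) j hjD')

theorem exists_forall_lt_mem_of_isOpen {U : Set (ℕ → Bool)} (hU : IsOpen U) {z : ℕ → Bool}
    (hz : z ∈ U) : ∃ l, ∀ y : ℕ → Bool, (∀ j < l, y j = z j) → y ∈ U := by
  obtain ⟨I, u, hu, hsub⟩ := isOpen_pi_iff.1 hU z hz
  refine ⟨I.sup id + 1, fun y hy => hsub fun j hj => ?_⟩
  rw [hy j (Nat.lt_succ_of_le (Finset.le_sup (f := id) hj))]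
  exact (hu j hj).2

/-- The finitely supported points of the Cantor space with support below `m`. -/
def supportedBelow (m : ℕ) : Set (ℕ → Bool) := {s | ∀ j, m ≤ j → s j = false}

theorem finite_supportedBelow (m : ℕ) : (supportedBelow m).Finite := by
  refine Set.Finite.of_finite_image (f := fun s (j : Fin m) => s j) (toFinite _) ?_
  intro s hs t ht hst
  funext j
  by_cases hj : j < m
  · exact congr_fun hst ⟨j, hj⟩
  · rw [hs j (not_lt.1 hj), ht j (not_lt.1 hj)]

/-- Translation of the Cantor space by `s`. -/
def translate (s : ℕ → Bool) (y : ℕ → Bool) : ℕ → Bool := fun j => xor (y j) (s j)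

theorem continuous_translate (s : ℕ → Bool) : Continuous (translate s) :=
  continuous_pi fun j => (continuous_of_discreteTopology (f := fun b => xor b (s j))).comp
    (continuous_apply j)

theorem translate_translate (s y : ℕ → Bool) : translate s (translate s y) = y := by
  funext j
  simp [translate]

theorem dense_preimage_translate {O : Set (ℕ → Bool)} (hO : Dense O) (s : ℕ → Bool) :
    Dense (translate s ⁻¹' O) := by
  let e : (ℕ → Bool) ≃ₜ (ℕ → Bool) :=
    { toFun := translate s, invFun := translate s,
      left_inv := translate_translate s, right_inv := translate_translate s,
      continuous_toFun := continuous_translate s, continuous_invFun := continuous_translate s }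
  exact hO.preimage e.isOpenMap

theorem exists_translate_eq (m : ℕ) {y z : ℕ → Bool} (h : ∀ j, m ≤ j → y j = z j) :
    ∃ s ∈ supportedBelow m, translate s z = y := by
  refine ⟨fun j => xor (z j) (y j), fun j hj => by simp [h j hj], ?_⟩
  funext j
  simp [translate]

/-- A dense open set can be entered by fixing finitely many coordinates beyond `m`,
whatever the coordinates below `m` are. -/
theorem exists_cyl_subset_of_dense {O : Set (ℕ → Bool)} (hO : IsOpen O) (hd : Dense O) (m : ℕ)
    {D : Set ℕ} (hD : ∃ r, ∀ j ≥ r, j ∈ D) (x : ℕ → Bool) :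
    ∃ D' x', (∃ r, ∀ j ≥ r, j ∈ D') ∧ D' ⊆ D ∧ (∀ j ∈ D, j < m → j ∈ D') ∧
      (∀ j, j ∉ D → x' j = x j) ∧ cyl m D' x' ⊆ O := by
  obtain ⟨r, hr⟩ := hD
  have hfin := finite_supportedBelow m
  have hO' : IsOpen (⋂ s ∈ supportedBelow m, translate s ⁻¹' O) :=
    hfin.isOpen_biInter fun s _ => hO.preimage (continuous_translate s)
  have hd' : Dense (⋂ s ∈ supportedBelow m, translate s ⁻¹' O) :=
    dense_biInter_of_isOpen (fun s _ => hO.preimage (continuous_translate s)) hfin.countable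
      fun s _ => dense_preimage_translate hd s
  have hN : IsOpen {y : ℕ → Bool | ∀ j ∈ Iio r, y j = x j} := by
    simp only [ofPred_forall]
    exact (finite_Iio r).isOpen_biInter fun j _ =>
      (isOpen_discrete {x j}).preimage (continuous_apply (A := fun _ => Bool) j)
  obtain ⟨z, hzN, hz⟩ := hd'.inter_open_nonempty _ hN ⟨x, fun j _ => rfl⟩
  obtain ⟨l, hl⟩ := exists_forall_lt_mem_of_isOpen hO' hz
  refine ⟨{j ∈ D | j < m ∨ l ≤ j}, z, ⟨max r l, fun j hj => ?_⟩, fun j hj => hj.1,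
    fun j hj hjm => ⟨hj, Or.inl hjm⟩, fun j hj => hzN j (not_le.1 fun h => hj (hr j h)), ?_⟩
  · exact ⟨hr j (le_of_max_le_left hj), Or.inr (le_of_max_le_right hj)⟩
  · intro y hy
    obtain ⟨s, hs, hsy⟩ := exists_translate_eq m (y := y)
      (z := fun j => if j < m then z j else y j) fun j hj => by simp [not_lt.2 hj]
    rw [← hsy]
    refine mem_iInter₂.1 (hl _ fun j hj => ?_) s hs
    split_ifs with hjm
    · rfl
    · exact hy j (not_lt.1 hjm) fun h => h.2.elim hjm (not_le.2 hj)

theorem exists_cyl_subset_of_iUnion {Y : ℕ → Set (ℕ → Bool)} (hY : ∀ k, MeasurableSet (Y k))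
    (hU : ⋃ k, Y k = univ) : ∃ k D x, D.Infinite ∧ cyl 0 D x ⊆ Y k := by
  choose U hUo hYU using fun k => (hY k).residualEq_isOpen
  have hne : ∃ k, (U k).Nonempty := by
    by_contra! h
    have : ∀ᶠ z in residual (ℕ → Bool), ∀ k, z ∉ Y k := by
      rw [eventually_countable_forall]
      intro k
      have hk := hYU k
      rw [h k] at hk
      exact hk.mem_iff.mono fun z hz hzY => (hz.1 hzY).elim
    obtain ⟨z, hz⟩ := (dense_of_mem_residual this).nonempty
    obtain ⟨k, hk⟩ := mem_iUnion.1 (hU.symm ▸ mem_univ z : z ∈ ⋃ k, Y k)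
    exact hz k hk
  obtain ⟨k, z, hz⟩ := hne
  obtain ⟨S, hSo, hSd, hSc, hS⟩ := mem_residual_iff.1 (hYU k).mem_iff
  obtain ⟨O, hO⟩ := (hSc.insert univ).exists_eq_range (insert_nonempty _ _)
  have hOS : ∀ n, IsOpen (O n) ∧ Dense (O n) := by
    intro n
    rcases (hO.symm ▸ mem_range_self n : O n ∈ insert univ S) with h | h
    · rw [h]; exact ⟨isOpen_univ, dense_univ⟩
    · exact ⟨hSo _ h, hSd _ h⟩
  obtain ⟨l, hl⟩ := exists_forall_lt_mem_of_isOpen (hUo k) hz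
  obtain ⟨D, x, hD, hDl, hx, μ, -, hμ⟩ := exists_fusion (C := fun D _ => ∃ r, ∀ j ≥ r, j ∈ D)
    (fun D _ ⟨r, hr⟩ => (Set.Ici_infinite r).mono hr) (𝒮 := fun n => {T | T ⊆ O n})
    (fun n T T' h h' => h.trans h')
    (fun n m D x hD => exists_cyl_subset_of_dense (hOS n).1 (hOS n).2 m hD x)
    (D := Ici l) (x := z) ⟨l, fun j hj => hj⟩
  refine ⟨k, D, x, hD, fun y hy => ?_⟩
  have hyS : y ∈ ⋂₀ S := by
    intro T hT
    obtain ⟨n, rfl⟩ := (hO ▸ Or.inr hT : T ∈ range O)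
    exact hμ n fun j _ hjD => hy j (Nat.zero_le j) hjD
  refine (hS hyS).2 (hl y fun j hj => ?_)
  rw [← hx j (not_le.2 hj)]
  exact hy j (Nat.zero_le j) fun h => not_le.2 hj (hDl h)

theorem exists_cyl_subset_of_omega {W : ℕ → Set (ℕ → Bool)} (hW : ∀ k, MeasurableSet (W k))
    {D : Set ℕ} (hD : D.Infinite) (x : ℕ → Bool)
    (hω : ∀ F ⊆ hull D x, F.Finite → ∃ k, F ⊆ W k) (m : ℕ) :
    ∃ k D' x', D'.Infinite ∧ D' ⊆ D ∧ (∀ j ∈ D, j < m → j ∈ D') ∧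
      (∀ j, j ∉ D → x' j = x j) ∧ cyl m D' x' ⊆ W k := by
  have hD₀ : (D ∩ Ici m).Infinite := by
    refine (hD.sdiff (finite_Iio m)).mono fun j hj => ⟨hj.1, mem_Ici.2 (not_lt.1 hj.2)⟩
  obtain ⟨e, he, heD⟩ : ∃ e : ℕ → ℕ, StrictMono e ∧ range e = D ∩ Ici m :=
    ⟨Nat.nth (· ∈ D ∩ Ici m), Nat.nth_strictMono hD₀, Nat.range_nth_of_infinite hD₀⟩
  have hei : ∀ i, e i ∈ D ∩ Ici m := fun i => heD ▸ mem_range_self i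
  have hext : ∀ (z : ℕ → Bool) j, j ∉ D ∩ Ici m → Function.extend e z x j = x j := by
    intro z j hj
    refine Function.extend_apply' _ _ _ ?_
    rwa [← heD] at hj
  have hmeas : Measurable fun z : ℕ → Bool => Function.extend e z x := by
    refine measurable_pi_lambda _ fun j => ?_
    by_cases hj : j ∈ range e
    · obtain ⟨i, rfl⟩ := hj
      simpa only [he.injective.extend_apply] using measurable_pi_apply i
    · simp only [hext _ j (heD ▸ hj), measurable_const]
  obtain ⟨k, D₁, x₁, hD₁, hcyl⟩ := exists_cyl_subset_of_iUnion
    (Y := fun k => ⋂ s ∈ supportedBelow m,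
      (fun z => translate s (Function.extend e z x)) ⁻¹' W k)
    (fun k => MeasurableSet.biInter (finite_supportedBelow m).countable fun s _ =>
      ((continuous_translate s).measurable.comp hmeas) (hW k)) (by
    refine eq_univ_of_forall fun z => ?_
    obtain ⟨k, hk⟩ := hω ((fun s => translate s (Function.extend e z x)) '' supportedBelow m) (by
      rintro _ ⟨s, hs, rfl⟩
      refine cyl_subset_hull m D x fun j hj hjD => ?_
      simp [translate, hs j hj, hext z j fun h => hjD h.1]) ((finite_supportedBelow m).image _)
    exact mem_iUnion.2 ⟨k, mem_iInter₂.2 fun s hs => hk ⟨s, hs, rfl⟩⟩)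
  refine ⟨k, {j ∈ D | j < m} ∪ e '' D₁, Function.extend e x₁ x, ?_, ?_, ?_, ?_, ?_⟩
  · exact (hD₁.image he.injective.injOn).mono subset_union_right
  · rintro j (hj | ⟨i, -, rfl⟩)
    exacts [hj.1, (hei i).1]
  · exact fun j hj hjm => Or.inl ⟨hj, hjm⟩
  · exact fun j hj => hext x₁ j fun h => hj h.1
  · intro y hy
    have hz : (fun i => y (e i)) ∈ cyl 0 D₁ x₁ := by
      intro i _ hi
      refine (hy (e i) (hei i).2 ?_).trans (he.injective.extend_apply _ _ _)
      rintro (h | ⟨i', hi', h⟩)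
      · exact not_le.2 h.2 (hei i).2
      · exact hi (he.injective h ▸ hi')
    obtain ⟨s, hs, hsy⟩ := exists_translate_eq m (y := y)
      (z := Function.extend e (fun i => y (e i)) x) (by
      intro j hj
      by_cases hjD : j ∈ D ∩ Ici m
      · obtain ⟨i, rfl⟩ : j ∈ range e := heD ▸ hjD
        rw [he.injective.extend_apply]
      · rw [hext _ j hjD, hy j hj, hext _ j hjD]
        rintro (h | ⟨i, -, rfl⟩)
        · exact hjD ⟨h.1, hj⟩
        · exact hjD (hei i))
    rw [← hsy]
    exact mem_iInter₂.1 (hcyl hz) s hs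

theorem exists_selection_on_hull {E : Set (ℕ → Bool)} (hE : E.Countable)
    {W : ℕ → ℕ → Set (ℕ → Bool)} (hW : ∀ n k, MeasurableSet (W n k))
    {D : Set ℕ} (hD : D.Infinite) (x : ℕ → Bool)
    (hω : ∀ n, ∀ F ⊆ E ∪ hull D x, F.Finite → ∃ k, F ⊆ W n k) :
    ∃ D' x', D'.Infinite ∧ D' ⊆ D ∧ (∀ j, j ∉ D → x' j = x j) ∧
      ∃ g : ℕ → ℕ, ∀ y ∈ E ∪ hull D' x', ∀ᶠ n in atTop, y ∈ W n (g n) := by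
  have hx : x ∈ hull D x := by simp [hull]
  obtain ⟨ε, hε⟩ := (hE.insert x).exists_eq_range (insert_nonempty _ _)
  have hεE : ∀ n, ε '' Iio n ⊆ E ∪ hull D x := by
    rintro n _ ⟨i, -, rfl⟩
    rcases (hε.symm ▸ mem_range_self i : ε i ∈ insert x E) with h | h
    · rw [h]; exact Or.inr hx
    · exact Or.inl h
  obtain ⟨D', x', h1, h2, h3, μ, hμ, h4⟩ := exists_fusion
    (C := fun D' x' => D'.Infinite ∧ hull D' x' ⊆ hull D x) (fun D' x' h => h.1)
    (𝒮 := fun n => {T | ∃ k, T ⊆ W n k ∧ ε '' Iio n ⊆ W n k})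
    (fun n T T' h ⟨k, hk⟩ => ⟨k, h.trans hk.1, hk.2⟩)
    (fun n m D₁ x₁ ⟨hD₁, hsub⟩ => by
      obtain ⟨k, D₂, x₂, hD₂, h₁, h₂, h₃, h₄⟩ := exists_cyl_subset_of_omega
        (W := fun k => W n k ∩ {_y | ε '' Iio n ⊆ W n k})
        (fun k => (hW n k).inter (MeasurableSet.const _)) hD₁ x₁ (by
          intro F hF hfin
          obtain ⟨k, hk⟩ := hω n (F ∪ ε '' Iio n)
            (union_subset (hF.trans (hsub.trans subset_union_right)) (hεE n))
            (hfin.union ((finite_Iio n).image ε))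
          exact ⟨k, fun y hy => ⟨hk (Or.inl hy), subset_union_right.trans hk⟩⟩) m
      have hx₂ : x₂ ∈ cyl m D₂ x₂ := fun j _ _ => rfl
      exact ⟨D₂, x₂, ⟨hD₂, (hull_subset_hull
        (by rw [sdiff_eq_bot_iff.2 h₁]; exact finite_empty) (mem_hull_of_eq h₃)).trans hsub⟩, h₁, h₂, h₃, k,
        fun y hy => (h₄ hy).1, (h₄ hx₂).2⟩)
    (D := D) (x := x) ⟨hD, Subset.rfl⟩
  choose g hg1 hg2 using h4
  refine ⟨D', x', h1, h2, h3, g, ?_⟩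
  rintro y (hy | hy)
  · obtain ⟨i, rfl⟩ : y ∈ range ε := hε ▸ Or.inr hy
    filter_upwards [eventually_gt_atTop i] with n hn
    exact hg2 n ⟨i, hn, rfl⟩
  · obtain ⟨N, hN⟩ := exists_mem_cyl_of_mem_hull hy
    filter_upwards [eventually_ge_atTop N] with n hn
    exact hg1 n (hN _ (hn.trans (hμ n)))

open Cardinal in
/-- In a `σ`-closed preorder there is a chain meeting any given `ℵ₁` cofinal sets. -/
theorem exists_chain_meeting {P : Type*} [Preorder P] [Nonempty P]
    (hσ : ∀ p : ℕ → P, Monotone p → ∃ q, ∀ n, p n ≤ q) {τ : Type} (hτ : #τ ≤ ℵ₁)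
    (𝒟 : τ → Set P) (h𝒟 : ∀ t p, ∃ q ∈ 𝒟 t, p ≤ q) :
    ∃ G : τ → P, (∀ t, G t ∈ 𝒟 t) ∧ ∀ s t, G s ≤ G t ∨ G t ≤ G s := by
  obtain ⟨r, wo, hr⟩ := exists_ord_eq τ
  have hcount : ∀ t, Countable {s // r s t} := by
    intro t
    rw [← Cardinal.mk_le_aleph0_iff, ← Order.lt_succ_iff, succ_aleph0]
    exact (card_typein_lt t hr).trans_le hτ
  classical
  let step : ∀ t, (∀ s, r s t → P) → P := fun t prev =>
    if h : ∃ p ∈ 𝒟 t, ∀ s hs, prev s hs ≤ p then h.choose else Classical.arbitrary P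
  let G : τ → P := wo.wf.fix step
  have hG : ∀ t, G t ∈ 𝒟 t ∧ ∀ s, r s t → G s ≤ G t := by
    intro t
    induction t using wo.wf.induction with
    | _ t ih =>
      have hub : ∃ q, ∀ s, r s t → G s ≤ q := by
        by_cases hne : Nonempty {s // r s t}
        · have := hcount t
          let _ := Encodable.ofCountable {s // r s t}
          let _ : Inhabited {s // r s t} := Classical.inhabited_of_nonempty hne
          have hdir : Directed (· ≤ ·) fun s : {s // r s t} => G s := by
            rintro ⟨s, hs⟩ ⟨s', hs'⟩
            rcases trichotomous_of r s s' with h | rfl | h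
            · exact ⟨⟨s', hs'⟩, (ih s' hs').2 s h, le_rfl⟩
            · exact ⟨⟨s, hs⟩, le_rfl, le_rfl⟩
            · exact ⟨⟨s, hs⟩, le_rfl, (ih s hs).2 s' h⟩
          obtain ⟨q, hq⟩ := hσ _ hdir.sequence_mono
          exact ⟨q, fun s hs => (hdir.le_sequence ⟨s, hs⟩).trans (hq _)⟩
        · exact ⟨Classical.arbitrary P, fun s hs => (hne ⟨⟨s, hs⟩⟩).elim⟩
      obtain ⟨q, hq⟩ := hub
      obtain ⟨q', hq', hqq'⟩ := h𝒟 t q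
      have h : ∃ p ∈ 𝒟 t, ∀ s, r s t → G s ≤ p := ⟨q', hq', fun s hs => (hq s hs).trans hqq'⟩
      have hGt : G t = h.choose := by
        simp only [G]
        rw [wo.wf.fix_eq]
        exact dif_pos h
      rw [hGt]
      exact h.choose_spec
  refine ⟨G, fun t => (hG t).1, fun s t => ?_⟩
  rcases trichotomous_of r s t with h | rfl | h
  · exact Or.inl ((hG t).2 s h)
  · exact Or.inl le_rfl
  · exact Or.inr ((hG s).2 t h)

/-- A sequence of partial functions with infinite co-domains that increases modulo finite sets has
an upper bound modulo finite sets. -/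
theorem exists_hull_bound {D : ℕ → Set ℕ} {x : ℕ → ℕ → Bool} (hinf : ∀ n, (D n).Infinite)
    (hD : ∀ i j, i ≤ j → (D j \ D i).Finite) (hx : ∀ i j, i ≤ j → x j ∈ hull (D i) (x i)) :
    ∃ D' x', D'.Infinite ∧ ∀ n, (D' \ D n).Finite ∧ x' ∈ hull (D n) (x n) := by
  have hmeet : ∀ j, ∃ d, j ≤ d ∧ ∀ i ≤ j, d ∈ D i := by
    intro j
    have hfin : (⋃ i ∈ Iic j, D j \ D i).Finite := (finite_Iic j).biUnion fun i hi => hD i j hi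
    obtain ⟨d, hd, hjd⟩ := ((hinf j).sdiff hfin).exists_gt j
    refine ⟨d, hjd.le, fun i hi => by_contra fun h => hd.2 ?_⟩
    exact mem_biUnion (mem_Iic.2 hi) ⟨hd.1, h⟩
  choose d hd hdD using hmeet
  let Q : ℕ → ℕ → Prop := fun n j => ∀ i ≤ j, ∀ l, n ≤ l → l ∉ D i → x j l = x i l
  have hQ : ∀ j, ∀ᶠ n in atTop, Q n j := by
    intro j
    have : ∀ᶠ n in atTop, ∀ i ∈ Iic j, ∀ l, n ≤ l → l ∉ D i → x j l = x i l := by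
      rw [eventually_all_finite (finite_Iic j)]
      intro i hi
      obtain ⟨N, hN⟩ := exists_mem_cyl_of_mem_hull (hx i j hi)
      filter_upwards [eventually_ge_atTop N] with n hn
      exact hN n hn
    exact this
  classical
  let J : ℕ → ℕ := fun n => Nat.findGreatest (Q n) n
  have hJ : ∀ n, Q n (J n) := by
    intro n
    refine Nat.findGreatest_spec (P := Q n) (Nat.zero_le n) ?_
    intro i hi l _ _
    rw [Nat.le_zero.1 hi]
  refine ⟨range d, fun n => x (J n) n, ?_, fun n => ⟨?_, ?_⟩⟩
  · rw [Set.infinite_iff_exists_gt]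
    exact fun n => ⟨d (n + 1), mem_range_self _, hd (n + 1)⟩
  · refine ((finite_Iio n).image d).subset ?_
    rintro _ ⟨⟨j, rfl⟩, hj⟩
    exact ⟨j, not_le.1 fun h => hj (hdD j n h), rfl⟩
  · have hlarge : ∀ᶠ l in atTop, n ≤ J l := by
      filter_upwards [hQ n, eventually_ge_atTop n] with l hl hnl
      exact Nat.le_findGreatest hnl hl
    obtain ⟨N, hN⟩ := eventually_atTop.1 hlarge
    refine (finite_Iio N).subset ?_
    rintro l ⟨hl, hne⟩
    exact not_le.1 fun h => hne (hJ l n (hN l h) l le_rfl hl)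

theorem not_countable_hull {D : Set ℕ} (hD : D.Infinite) (x : ℕ → Bool) :
    ¬ (hull D x).Countable := by
  intro hc
  obtain ⟨ε, hε⟩ := hc.exists_eq_range ⟨x, mem_hull_of_eq fun j _ => rfl⟩
  obtain ⟨e, he, heD⟩ : ∃ e : ℕ → ℕ, Function.Injective e ∧ range e = D :=
    ⟨Nat.nth (· ∈ D), Nat.nth_injective hD, Nat.range_nth_of_infinite hD⟩
  have hmem : Function.extend e (fun i => !(ε i (e i))) x ∈ hull D x := by
    refine mem_hull_of_eq fun j hj => Function.extend_apply' _ _ _ ?_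
    rwa [← heD] at hj
  rw [hε] at hmem
  obtain ⟨i, hi⟩ := hmem
  have := congr_fun hi (e i)
  rw [he.extend_apply] at this
  simp at this

/-- Approximations to a pair of disjoint sets of points of the Cantor space: countable parts of
both sets, and a hull to which all later points have to belong. -/
structure Approximation where
  free : Set ℕ
  base : ℕ → Bool
  pts : Bool → Set (ℕ → Bool)
  infinite_free : free.Infinite
  countable_pts : ∀ b, (pts b).Countable
  disjoint_pts : ∀ b, Disjoint (pts b) (pts !b)

namespace Approximation

/-- The hull of an approximation. -/
def room (p : Approximation) : Set (ℕ → Bool) := hull p.free p.base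

instance : Preorder Approximation where
  le p q := (q.free \ p.free).Finite ∧ q.base ∈ p.room ∧
    ∀ b, p.pts b ⊆ q.pts b ∧ q.pts b ⊆ p.pts b ∪ p.room
  le_refl p := ⟨by simp, by simp [room, hull], fun b => ⟨Subset.rfl, subset_union_left⟩⟩
  le_trans p q r hpq hqr := by
    have hroom : q.room ⊆ p.room := hull_subset_hull hpq.1 hpq.2.1
    refine ⟨(hpq.1.union hqr.1).subset fun j hj => ?_, hroom hqr.2.1,
      fun b => ⟨(hpq.2.2 b).1.trans (hqr.2.2 b).1, fun y hy => ?_⟩⟩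
    · by_cases h : j ∈ q.free
      exacts [Or.inl ⟨h, hj.2⟩, Or.inr ⟨hj.1, h⟩]
    · rcases (hqr.2.2 b).2 hy with h | h
      exacts [(hpq.2.2 b).2 h, Or.inr (hroom h)]

theorem le_iff {p q : Approximation} : p ≤ q ↔ (q.free \ p.free).Finite ∧ q.base ∈ p.room ∧
    ∀ b, p.pts b ⊆ q.pts b ∧ q.pts b ⊆ p.pts b ∪ p.room := Iff.rfl

instance : Nonempty Approximation :=
  ⟨⟨univ, fun _ => false, fun _ => ∅, infinite_univ, fun _ => countable_empty,
    fun _ => disjoint_bot_left⟩⟩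

theorem exists_upper_bound (p : ℕ → Approximation) (hp : Monotone p) : ∃ q, ∀ n, p n ≤ q := by
  obtain ⟨D, x, hD, h⟩ := exists_hull_bound (fun n => (p n).infinite_free)
    (fun i j hij => (le_iff.1 (hp hij)).1) (fun i j hij => (le_iff.1 (hp hij)).2.1)
  refine ⟨⟨D, x, fun b => ⋃ n, (p n).pts b, hD, fun b => countable_iUnion fun n =>
    (p n).countable_pts b, fun b => ?_⟩, fun n => le_iff.2 ⟨(h n).1, (h n).2, fun b =>
      ⟨subset_iUnion (fun n => (p n).pts b) n, iUnion_subset fun i => ?_⟩⟩⟩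
  · rw [disjoint_iUnion_left]
    intro i
    rw [disjoint_iUnion_right]
    intro j
    refine ((p (max i j)).disjoint_pts b).mono ?_ ?_
    · exact ((le_iff.1 (hp (le_max_left i j))).2.2 b).1
    · exact ((le_iff.1 (hp (le_max_right i j))).2.2 _).1
  · rcases le_total i n with hin | hni
    · exact ((le_iff.1 (hp hin)).2.2 b).1.trans subset_union_left
    · exact ((le_iff.1 (hp hni)).2.2 b).2

/-- Adding countably many new points. -/
theorem exists_insert (p : Approximation) (b : Bool) {F : Set (ℕ → Bool)} (hF : F.Countable)
    (hroom : F ⊆ p.room) (hdisj : Disjoint F (p.pts !b)) :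
    ∃ q, p ≤ q ∧ q.pts b = p.pts b ∪ F := by
  have hb : (!b) ≠ b := by cases b <;> simp
  refine ⟨⟨p.free, p.base, Function.update p.pts b (p.pts b ∪ F), p.infinite_free, fun c => ?_,
    fun c => ?_⟩, ⟨by simp, by simp [room, hull], fun c => ?_⟩, by simp⟩
  · by_cases hc : c = b
    · subst hc
      simpa using ⟨p.countable_pts c, hF⟩
    · rw [Function.update_of_ne hc]
      exact p.countable_pts c
  · by_cases hc : c = b
    · subst hc
      rw [Function.update_self, Function.update_of_ne hb]
      exact (p.disjoint_pts c).union_left hdisj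
    · obtain rfl : c = !b := by cases b <;> cases c <;> simp_all
      rw [Function.update_of_ne hc, Bool.not_not, Function.update_self]
      exact ((p.disjoint_pts b).union_left hdisj).symm
  · by_cases hc : c = b
    · subst hc
      simpa using hroom.trans subset_union_right
    · simp [Function.update_of_ne hc]

/-- Either all points in sight are captured by a selection from `W`, or the points put into the
`b`-th set show that some `W n` does not catch all its finite subsets. -/
def Decides (b : Bool) (W : ℕ → ℕ → Set (ℕ → Bool)) (p : Approximation) : Prop :=
  (∃ g : ℕ → ℕ, ∀ y ∈ p.pts b ∪ (p.room \ p.pts !b), ∀ᶠ n in atTop, y ∈ W n (g n)) ∨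
    ∃ n, ∃ F ⊆ p.pts b, F.Finite ∧ ∀ k, ¬ F ⊆ W n k

theorem exists_decides (p : Approximation) (b : Bool) {W : ℕ → ℕ → Set (ℕ → Bool)}
    (hW : ∀ n k, MeasurableSet (W n k)) : ∃ q, Decides b W q ∧ p ≤ q := by
  by_cases hω : ∀ n, ∀ F ⊆ p.pts b ∪ (p.room \ p.pts !b), F.Finite → ∃ k, F ⊆ W n k
  · have hm : MeasurableSet (p.pts !b) := (p.countable_pts _).measurableSet
    obtain ⟨D, x, hD, hDp, hx, g, hg⟩ := exists_selection_on_hull (p.countable_pts b)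
      (W := fun n k => W n k ∪ p.pts !b) (fun n k => (hW n k).union hm) p.infinite_free p.base (by
        intro n F hF hfin
        obtain ⟨k, hk⟩ := hω n (F \ p.pts !b) (by
          rintro y ⟨hy, hyb⟩
          exact (hF hy).imp id fun h => ⟨h, hyb⟩) (hfin.subset sdiff_subset)
        refine ⟨k, fun y hy => ?_⟩
        by_cases hyb : y ∈ p.pts !b
        exacts [Or.inr hyb, Or.inl (hk ⟨hy, hyb⟩)])
    refine ⟨⟨D, x, p.pts, hD, p.countable_pts, p.disjoint_pts⟩, Or.inl ⟨g, fun y hy => ?_⟩,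
      le_iff.2 ⟨?_, mem_hull_of_eq hx, fun c => ⟨Subset.rfl, subset_union_left⟩⟩⟩
    · have hyb : y ∉ p.pts !b := by
        rcases hy with hy | hy
        exacts [(p.disjoint_pts b).notMem_of_mem_left hy, hy.2]
      exact (hg y (hy.imp id And.left)).mono fun n hn => hn.resolve_right hyb
    · rw [sdiff_eq_bot_iff.2 hDp]
      exact finite_empty
  · push Not at hω
    obtain ⟨n, F, hF, hfin, hk⟩ := hω
    obtain ⟨q, hpq, hq⟩ := p.exists_insert b (F := F \ p.pts b)
      (hfin.subset sdiff_subset).countable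
      (fun y hy => ((hF hy.1).resolve_left hy.2).1) (disjoint_left.2 fun y hy =>
        ((hF hy.1).resolve_left hy.2).2)
    refine ⟨q, Or.inr ⟨n, F, ?_, hfin, hk⟩, hpq⟩
    rw [hq, union_sdiff_self]
    exact subset_union_right

/-- `G` does not separate the two sets under construction. -/
def NotSeparated (G : Set (ℕ → Bool)) (p : Approximation) : Prop :=
  (∃ y ∈ p.pts false, y ∉ G) ∨ ∃ y ∈ p.pts true, y ∈ G

theorem exists_notSeparated (p : Approximation) (G : Set (ℕ → Bool)) :
    ∃ q, NotSeparated G q ∧ p ≤ q := by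
  have hc : (p.pts false ∪ p.pts true).Countable :=
    (p.countable_pts false).union (p.countable_pts true)
  obtain ⟨y, hy, hyp⟩ : ∃ y ∈ p.room, y ∉ p.pts false ∪ p.pts true := by
    by_contra! h
    exact not_countable_hull p.infinite_free p.base (hc.mono h)
  have hyp' : ∀ b, y ∉ p.pts b := by
    rintro (_ | _)
    exacts [fun h => hyp (Or.inl h), fun h => hyp (Or.inr h)]
  have key : ∀ b, ∃ q, p ≤ q ∧ q.pts b = p.pts b ∪ {y} := fun b =>
    p.exists_insert b (countable_singleton y) (by simpa using hy) (by simpa using hyp' _)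
  by_cases hG : y ∈ G
  · obtain ⟨q, hpq, hq⟩ := key true
    exact ⟨q, Or.inr ⟨y, by simp [hq], hG⟩, hpq⟩
  · obtain ⟨q, hpq, hq⟩ := key false
    exact ⟨q, Or.inl ⟨y, by simp [hq], hG⟩, hpq⟩

end Approximation

open Cardinal in
theorem mk_tasks_le (hCH : continuum.{0} = aleph.{0} 1) :
    #(Option Bool × (ℕ → ℕ → {s : Set (ℕ → Bool) // MeasurableSet s})) ≤ ℵ₁ := by
  have h : #{s : Set (ℕ → Bool) // MeasurableSet s} ≤ 𝔠 := by
    obtain ⟨B, hB, hgen⟩ :=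
      MeasurableSpace.CountablyGenerated.isCountablyGenerated (α := ℕ → Bool)
    rw [hgen]
    exact MeasurableSpace.cardinal_measurableSet_le_continuum
      (hB.le_aleph0.trans aleph0_le_continuum)
  rw [← hCH, mk_prod, lift_id, lift_id]
  refine mul_le_of_le aleph0_le_continuum ?_ ?_
  · exact (mk_le_aleph0 (α := Option Bool)).trans aleph0_le_continuum
  · rw [← mk_congr (Equiv.curry ℕ ℕ _), ← power_def]
    refine (power_le_power_right h).trans ?_
    simp

open Cardinal Approximation in
theorem exists_selective_not_separated (hCH : continuum.{0} = aleph.{0} 1) :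
    ∃ S : Bool → Set (ℕ → Bool), (∀ b, IsBorelSelective (S b)) ∧ Disjoint (S false) (S true) ∧
      ∀ G, MeasurableSet G → ¬ (S false ⊆ G ∧ Disjoint (S true) G) := by
  obtain ⟨G, hG, hchain⟩ := exists_chain_meeting exists_upper_bound (mk_tasks_le hCH)
    (fun t => t.1.elim {p | NotSeparated (t.2 0 0) p}
      fun b => {p | Decides b (fun n k => t.2 n k) p}) (by
      rintro ⟨_ | b, W⟩ p
      exacts [p.exists_notSeparated _, p.exists_decides b fun n k => (W n k).2])
  have hdis : ∀ b s t, Disjoint ((G s).pts b) ((G t).pts !b) := by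
    intro b s t
    rcases hchain s t with h | h
    · exact ((G t).disjoint_pts b).mono_left (h.2.2 b).1
    · exact ((G s).disjoint_pts b).mono_right (h.2.2 _).1
  refine ⟨fun b => ⋃ t, (G t).pts b, fun b W hW hω => ?_, ?_, fun B hB => ?_⟩
  · let t : Option Bool × (ℕ → ℕ → {s : Set (ℕ → Bool) // MeasurableSet s}) :=
      (some b, fun n k => ⟨W n k, hW n k⟩)
    rcases (hG t : Decides b W (G t)) with ⟨g, hg⟩ | ⟨n, F, hF, hfin, hk⟩
    · refine ⟨g, fun y hy => hg y ?_⟩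
      obtain ⟨s, hs⟩ := mem_iUnion.1 hy
      rcases hchain s t with h | h
      · exact Or.inl ((h.2.2 b).1 hs)
      · exact ((h.2.2 b).2 hs).imp id fun hr =>
          ⟨hr, disjoint_left.1 (hdis b s t) hs⟩
    · obtain ⟨k, hk'⟩ := hω n F (hF.trans (subset_iUnion (fun t => (G t).pts b) t)) hfin
      exact (hk k hk').elim
  · rw [disjoint_iUnion_left]
    exact fun s => disjoint_iUnion_right.2 fun t => hdis false s t
  · rintro ⟨h1, h2⟩
    rcases (hG (none, fun _ _ => ⟨B, hB⟩) : NotSeparated B _) with ⟨y, hy, hyB⟩ | ⟨y, hy, hyB⟩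
    · exact hyB (h1 (mem_iUnion.2 ⟨_, hy⟩))
    · exact disjoint_left.1 h2 (mem_iUnion.2 ⟨_, hy⟩) hyB

theorem exists_embedding_cantor_real : ∃ i : (ℕ → Bool) → ℝ, Continuous i ∧ i.Injective := by
  have hP : Perfect (univ : Set ℝ) := PerfectSpace.univ_perfect ℝ
  obtain ⟨i, -, hi, hinj⟩ := hP.exists_nat_bool_injection univ_nonempty
  exact ⟨i, hi, hinj⟩

theorem isTopologicalBasis_isClopen_of_subset_range {K : Type*} [TopologicalSpace K]
    [CompactSpace K] [T2Space K] [TotallyDisconnectedSpace K] {i : K → ℝ} (hi : Continuous i)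
    (hinj : i.Injective) {A : Set ℝ} (hA : A ⊆ range i) :
    TopologicalSpace.IsTopologicalBasis {s : Set A | IsClopen s} := by
  have hemb := hi.isClosedEmbedding hinj
  refine TopologicalSpace.isTopologicalBasis_of_isOpen_of_nhds (fun s hs => hs.isOpen) ?_
  rintro ⟨_, hx⟩ U hxU hU
  obtain ⟨x, rfl⟩ := hA hx
  obtain ⟨V, hV, rfl⟩ := isOpen_induced_iff.1 hU
  obtain ⟨C, hC, hxC, hCV⟩ := compact_exists_isClopen_in_isOpen (hV.preimage hi) hxU
  have himage : ∀ {C : Set K}, IsClopen C → IsClosed ((↑) ⁻¹' (i '' C) : Set A) := fun hC =>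
    (hemb.isClosedMap _ hC.isClosed).preimage continuous_subtype_val
  refine ⟨(↑) ⁻¹' (i '' C), ⟨himage hC, ?_⟩, ⟨x, hxC, rfl⟩, ?_⟩
  · rw [← isClosed_compl_iff]
    convert himage hC.compl using 1
    ext ⟨_, hy⟩
    obtain ⟨y, rfl⟩ := hA hy
    simp [hinj.mem_set_image]
  · rintro ⟨_, hy⟩ ⟨y, hyC, rfl⟩
    exact hCV hyC

/-- The closed set of the points `(b, x)` of the doubled space for which the truth value of
`x ∈ C` is `b`. -/
def twist (C : Set (ℕ → Bool)) : Set (Bool × (ℕ → Bool)) := {z | z.2 ∈ C ↔ z.1 = true}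

theorem isClosed_twist {C : Set (ℕ → Bool)} (hC : IsClopen C) : IsClosed (twist C) := by
  have : twist C = ({true} ×ˢ C) ∪ ({false} ×ˢ Cᶜ) := by
    ext ⟨b, x⟩
    cases b <;> simp [twist]
  rw [this]
  exact ((isClosed_discrete _).prod hC.isClosed).union
    ((isClosed_discrete _).prod hC.compl.isClosed)

theorem exists_isClopen_separating {F F' : Set (ℕ → Bool)} (hF : F.Finite) (hF' : F'.Finite)
    (h : Disjoint F F') : ∃ C, IsClopen C ∧ F ⊆ C ∧ Disjoint F' C := by
  obtain ⟨C, hC, h1, h2⟩ := exists_clopen_of_closed_subset_open hF.isClosed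
    hF'.isClosed.isOpen_compl (subset_compl_iff_disjoint_right.2 h)
  exact ⟨C, hC, h1, (subset_compl_iff_disjoint_left.1 h2)⟩

theorem s1_open_tau {X : Type*} [Nonempty X] [TopologicalSpace X] [MeasurableSpace X]
    [BorelSpace X] {S T : Set X} (hS : IsBorelSelective S) (hT : IsBorelSelective T)
    (hST : S ∪ T = univ) : S1 (openTau X) (openGamma X) := by
  intro 𝒰 h𝒰
  obtain ⟨V, hV, hVx⟩ := exists_selection_of_tau hS hT hST (fun n => (h𝒰 n).1.1)
    (fun n U hU => ((h𝒰 n).1.2 U hU).measurableSet) (fun n => (h𝒰 n).2)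
  refine ⟨V, hV, ⟨countable_range _, ?_⟩,
    isGammaCover_range (fun n hn => (h𝒰 n).2.1.1.2 (hn ▸ hV n)) hVx⟩
  rintro _ ⟨n, rfl⟩
  exact (h𝒰 n).1.2 _ (hV n)

theorem s1_borel_tau {X : Type*} [Nonempty X] [TopologicalSpace X] [MeasurableSpace X]
    [BorelSpace X] {S T : Set X} (hS : IsBorelSelective S) (hT : IsBorelSelective T)
    (hST : S ∪ T = univ) : S1 (borelTau X) (borelGamma X) := by
  intro 𝒰 h𝒰
  obtain ⟨V, hV, hVx⟩ := exists_selection_of_tau hS hT hST (fun n => (h𝒰 n).1.1)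
    (fun n U hU => by rw [BorelSpace.measurable_eq (α := X)]; exact (h𝒰 n).1.2 U hU)
    (fun n => (h𝒰 n).2)
  refine ⟨V, hV, ⟨countable_range _, ?_⟩,
    isGammaCover_range (fun n hn => (h𝒰 n).2.1.1.2 (hn ▸ hV n)) hVx⟩
  rintro _ ⟨n, rfl⟩
  exact (h𝒰 n).1.2 _ (hV n)

theorem choose_openTau_of_s1_open {X : Type*} [TopologicalSpace X]
    (h : S1 (openOmega X) (openGamma X)) : Choose (openOmega X) (openTau X) := by
  intro 𝒰 h𝒰
  obtain ⟨V, hV, hΓ⟩ := h (fun _ => 𝒰) fun _ => h𝒰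
  exact ⟨range V, range_subset_iff.2 hV, hΓ.1, hΓ.2.isTauCover⟩

theorem choose_openTau_of_s1_borel {X : Type*} [TopologicalSpace X]
    (h : S1 (borelOmega X) (borelGamma X)) : Choose (openOmega X) (openTau X) := by
  intro 𝒰 h𝒰
  obtain ⟨V, hV, hΓ⟩ := h (fun _ => 𝒰) fun _ => ⟨⟨h𝒰.1.1, fun U hU =>
    MeasurableSpace.measurableSet_generateFrom (h𝒰.1.2 U hU)⟩, h𝒰.2⟩
  exact ⟨range V, range_subset_iff.2 hV, ⟨countable_range _, fun U hU =>
    h𝒰.1.2 U (range_subset_iff.2 hV hU)⟩, hΓ.2.isTauCover⟩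

/-- If no Borel set separates `S false` from `S true`, then the clopen sets give rise to an open
`ω`-cover of the disjoint sum of the two sets which has no subcover selecting a `γ`-sequence. -/
theorem exists_omega_cover_without_gamma {i : Bool × (ℕ → Bool) → ℝ} (hi : Continuous i)
    (hinj : i.Injective) {S : Bool → Set (ℕ → Bool)} (hS : Disjoint (S false) (S true))
    (hsep : ∀ G, MeasurableSet G → ¬ (S false ⊆ G ∧ Disjoint (S true) G))
    {Z : Set ℝ} (hZ : Z = i '' {z | z.2 ∈ S z.1}) :
    ∃ 𝒰 ∈ openOmega Z, ∀ V : ℕ → Set Z, (∀ n, V n ∈ 𝒰) → ¬ ∀ x, ∀ᶠ n in atTop, x ∈ V n := by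
  have hmemZ : ∀ {b x}, x ∈ S b → i (b, x) ∈ Z := fun {b x} h => hZ ▸ ⟨(b, x), h, rfl⟩
  let U : TopologicalSpace.Clopens (ℕ → Bool) → Set Z := fun C => (↑) ⁻¹' (i '' twist C)ᶜ
  have hU : ∀ C b x (h : x ∈ S b), (⟨i (b, x), hmemZ h⟩ : Z) ∈ U C ↔ ¬ (x ∈ C ↔ b = true) := by
    intro C b x h
    simp [U, hinj.mem_set_image, twist]
  have hbad : ∀ C, U C ≠ univ := by
    intro C hC
    refine hsep C C.isClopen.isOpen.measurableSet ⟨fun x hx => ?_, disjoint_left.2 fun x hx hxC => ?_⟩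
    · have := (hU C false x hx).1 (hC ▸ mem_univ _)
      simpa using this
    · have := (hU C true x hx).1 (hC ▸ mem_univ _)
      exact this (by simpa using hxC)
  have hω : ∀ F : Set Z, F.Finite → ∃ C, F ⊆ U C := by
    intro F hF
    have hfin : ∀ b, {x | ∃ h : x ∈ S b, (⟨i (b, x), hmemZ h⟩ : Z) ∈ F}.Finite := by
      intro b
      refine Set.Finite.subset (Set.Finite.preimage (f := fun x => i (b, x)) ?_
        (hF.image Subtype.val)) ?_
      · exact fun x _ y _ hxy => (Prod.ext_iff.1 (hinj hxy)).2
      · rintro x ⟨h, hx⟩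
        exact ⟨_, hx, rfl⟩
    obtain ⟨C, hC, h1, h2⟩ := exists_isClopen_separating (hfin false) (hfin true)
      (hS.mono (fun x hx => hx.1) fun x hx => hx.1)
    refine ⟨⟨C, hC⟩, ?_⟩
    rintro ⟨z, hz⟩ hzF
    obtain ⟨⟨b, x⟩, hx, rfl⟩ : z ∈ i '' {z | z.2 ∈ S z.1} := hZ ▸ hz
    refine (hU _ b x hx).2 ?_
    have hxC : x ∈ (⟨C, hC⟩ : TopologicalSpace.Clopens (ℕ → Bool)) ↔ x ∈ C := Iff.rfl
    rw [hxC]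
    cases b
    · simpa using h1 ⟨hx, hzF⟩
    · simpa using disjoint_left.1 h2 ⟨hx, hzF⟩
  have : Countable (TopologicalSpace.Clopens (ℕ → Bool)) :=
    TopologicalSpace.Clopens.countable_iff_secondCountable.2 inferInstance
  refine ⟨range U, ⟨⟨countable_range U, ?_⟩, ⟨?_, ?_⟩, ?_⟩, ?_⟩
  · rintro _ ⟨C, rfl⟩
    refine IsOpen.preimage continuous_subtype_val (IsClosed.isOpen_compl (self := ?_))
    exact (hi.isClosedEmbedding hinj).isClosedMap _ (isClosed_twist C.isClopen)
  · refine eq_univ_of_forall fun z => ?_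
    obtain ⟨C, hC⟩ := hω {z} (finite_singleton z)
    exact ⟨U C, mem_range_self C, hC rfl⟩
  · rintro ⟨C, hC⟩
    exact hbad C hC
  · intro F hF
    obtain ⟨C, hC⟩ := hω F hF
    exact ⟨U C, mem_range_self C, hC⟩
  · intro V hV h
    choose C hC using hV
    refine hsep {x | ∀ᶠ n in atTop, x ∈ C n} ?_ ⟨fun x hx => ?_, disjoint_left.2 fun x hx hxG => ?_⟩
    · simp only [eventually_atTop, ofPred_exists, ofPred_forall]
      exact MeasurableSet.iUnion fun N => MeasurableSet.iInter fun n => MeasurableSet.iInter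
        fun _ => (C n).isClopen.isOpen.measurableSet
    · refine (h ⟨i (false, x), hmemZ hx⟩).mono fun n hn => ?_
      rw [← hC n, hU _ _ _ hx] at hn
      simpa using hn
    · obtain ⟨n, hn, hn'⟩ := ((h ⟨i (true, x), hmemZ hx⟩).and hxG).exists
      rw [← hC n, hU _ _ _ hx] at hn
      exact hn (by simpa using hn')

end TauCovers

open TauCovers

theorem mainTheorem1 (hCH : Cardinal.continuum.{0} = Cardinal.aleph.{0} 1) :
    (∃ A B : Set ℝ,
      TauCovers.IsAdmissible A ∧ TauCovers.IsAdmissible B ∧ TauCovers.IsAdmissible (A ∪ B) ∧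
      TauCovers.S1 (TauCovers.borelOmega A) (TauCovers.borelGamma A) ∧
      TauCovers.S1 (TauCovers.borelOmega B) (TauCovers.borelGamma B) ∧
      ¬ TauCovers.Choose (TauCovers.openOmega ↥(A ∪ B)) (TauCovers.openTau ↥(A ∪ B))) ∧
    {X : Set ℝ | TauCovers.IsAdmissible X ∧
        TauCovers.S1 (TauCovers.openTau X) (TauCovers.openGamma X)} ≠
      {X : Set ℝ | TauCovers.IsAdmissible X ∧
        TauCovers.S1 (TauCovers.openOmega X) (TauCovers.openGamma X)} ∧
    {X : Set ℝ | TauCovers.IsAdmissible X ∧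
        TauCovers.S1 (TauCovers.borelTau X) (TauCovers.borelGamma X)} ≠
      {X : Set ℝ | TauCovers.IsAdmissible X ∧
        TauCovers.S1 (TauCovers.borelOmega X) (TauCovers.borelGamma X)} := by
  obtain ⟨S, hS, hdisj, hsep⟩ := exists_selective_not_separated hCH
  obtain ⟨i, hi, hinj⟩ : ∃ i : Bool × (ℕ → Bool) → ℝ, Continuous i ∧ i.Injective := by
    obtain ⟨i, hi, hinj⟩ := exists_embedding_cantor_real
    refine ⟨fun z => i fun n => Nat.casesOn n z.1 z.2, hi.comp ?_, fun z w h => ?_⟩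
    · refine continuous_pi fun n => ?_
      cases n with
      | zero => exact continuous_fst
      | succ n => exact (continuous_apply n).comp continuous_snd
    · have := hinj h
      exact Prod.ext (congr_fun this 0) (funext fun n => congr_fun this (n + 1))
  have hinf : ∀ b, (S b).Infinite := by
    rintro (_ | _) hfin
    · exact hsep _ hfin.measurableSet ⟨Subset.rfl, hdisj.symm⟩
    · exact hsep _ hfin.measurableSet.compl ⟨subset_compl_iff_disjoint_right.2 hdisj,
        disjoint_compl_right⟩
  let A : Bool → Set ℝ := fun b => (fun x => i (b, x)) '' S b
  have hAinf : ∀ b, (A b).Infinite := fun b =>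
    (hinf b).image fun x _ y _ h => (Prod.ext_iff.1 (hinj h)).2
  have hAr : ∀ b, A b ⊆ range i := by
    rintro b _ ⟨x, -, rfl⟩
    exact mem_range_self _
  have hAsel : ∀ b, IsBorelSelective (A b) := fun b =>
    (hS b).image (hi.comp (Continuous.prodMk_right b)).measurable
  have hadm : ∀ b, IsAdmissible (A b) := fun b =>
    ⟨hAinf b, isTopologicalBasis_isClopen_of_subset_range hi hinj (hAr b)⟩
  have hadmU : IsAdmissible (A false ∪ A true) :=
    ⟨(hAinf false).mono subset_union_left, isTopologicalBasis_isClopen_of_subset_range hi hinj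
      (union_subset (hAr false) (hAr true))⟩
  have hs1 : ∀ b, S1 (borelOmega (A b)) (borelGamma (A b)) := fun b => by
    have := (hAinf b).nonempty.to_subtype
    refine IsBorelSelective.s1 ?_
    simpa using (hAsel b).preimage_val Subset.rfl
  have : Nonempty ↥(A false ∪ A true) := hadmU.1.nonempty.to_subtype
  have hfalse := (hAsel false).preimage_val (subset_union_left (t := A true))
  have htrue := (hAsel true).preimage_val (subset_union_right (s := A false))
  have hcover : ((↑) ⁻¹' A false ∪ (↑) ⁻¹' A true : Set ↥(A false ∪ A true)) = univ := by
    rw [← preimage_union]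
    exact Subtype.coe_preimage_self _
  have hnot : ¬ Choose (openOmega ↥(A false ∪ A true)) (openTau ↥(A false ∪ A true)) := by
    intro hchoose
    obtain ⟨𝒰, h𝒰, hno⟩ := exists_omega_cover_without_gamma hi hinj hdisj hsep
      (Z := A false ∪ A true) (by
        ext z
        constructor
        · rintro (⟨x, hx, rfl⟩ | ⟨x, hx, rfl⟩)
          exacts [⟨(false, x), hx, rfl⟩, ⟨(true, x), hx, rfl⟩]
        · rintro ⟨⟨_ | _, x⟩, hx, rfl⟩
          exacts [Or.inl ⟨x, hx, rfl⟩, Or.inr ⟨x, hx, rfl⟩])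
    obtain ⟨𝒱, h𝒱, hτ⟩ := hchoose 𝒰 h𝒰
    obtain ⟨V, hV, hVx⟩ := exists_selection_of_tau hfalse htrue hcover
      (𝒰 := fun _ => 𝒱) (fun _ => hτ.1.1) (fun _ U hU => (hτ.1.2 U hU).measurableSet)
      fun _ => hτ.2
    exact hno V (fun n => h𝒱 (hV n)) hVx
  refine ⟨⟨A false, A true, hadm false, hadm true, hadmU, hs1 false, hs1 true, hnot⟩, ?_, ?_⟩
  · intro heq
    exact hnot (choose_openTau_of_s1_open
      (heq.subset ⟨hadmU, s1_open_tau hfalse htrue hcover⟩ : _ ∧ _).2)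
  · intro heq
    exact hnot (choose_openTau_of_s1_borel
      (heq.subset ⟨hadmU, s1_borel_tau hfalse htrue hcover⟩ : _ ∧ _).2)
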